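/- Let $R=\mathbb{Z}_4+u\mathbb{Z}_4$ with $u^2=0$, let $n=2^k$ with $k\ge 1$, and let $R_n=R[x]/\langle x^n+1\rangle$; put $y=x+1\in R_n$. For an ideal $I$ of $R_n$ let $A(I)=\{r\in R_n : rI=0\}$ be its annihilator. Identify $(c_0,\dots,c_{n-1})\in R^n$ with $c_0+c_1x+\cdots+c_{n-1}x^{n-1}\in R_n$, so that an ideal $I$ is also a negacyclic code in $R^n$, and let $I^\perp=\{b\in R^n : a\cdot b=0 \text{ for all } a\in I\}$ be its dual for the Euclidean inner product. All exponents are non-negative integers. The letters $h,h_1,h_2$ denote polynomials over $\mathbb{Z}_4$; such a polynomial is called a unit if its reduction modulo $2$ is a unit of $\mathbb{Z}_2[x]/\langle x^n+1\rangle$. We write $h(x)$ and $h(1/x)$ for its values in $R_n$ at $x$ and at $x^{-1}=-x^{n-1}$. For $f\in R_n$ let $T(f)$ be the smallest $T\ge0$ with $uy^T\in\langle f\rangle$, and let $T_1(f)$ be the smallest $T_1\ge 0$ with $2uy^{T_1}\in\langle f\rangle$. Let $I$ be a non-principal ideal of $R_n$. (a) If $I=\langle y^s+uy^th(x),\ uy^m\rangle$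 with $1\le s<n$, $0\le t<m<s$, and $h$ zero or a unit, then $$A(I)=\langle y^{2n-m}+uy^{2n-m-s+t}h(x),\ uy^{2n-s}\rangle,\qquad I^\perp=\langle y^{2n-m}+ux^{s-t}y^{2n-m-s+t}h(1/x),\ uy^{2n-s}\rangle .$$ (b) Let $I=\langle f,\ uy^m\rangle$ with $f=y^s+uy^th(x)$, $n\le s<2n$, $0\le t<n$, $1+t\le m<T(f)$, and $h$ zero or a unit. If $h=0$ or $t\ge s+m-2n$, then $A(I)$ and $I^\perp$ are given by the formulas in (a) (for $h=0$ the terms containing $h$ are absent). If $h\ne0$ and $t<s+m-2n$, then $$A(I)=\langle y^{s-t}+uh(x),\ uy^{2n-s}\rangle,\qquad I^\perp=\langle y^{s-t}+ux^{s-t}h(1/x),\ uy^{2n-s}\rangle .$$ (c) If $I=\langle y^s+2uy^th(x),\ uy^m\rangle$ with $n<s\le 2n-1$, $0\le t<s-n$, $1+t\le m<n$, and $h$ a unit, then $A(I)=I^\perp=\langle y^{2n-m},\ uy^{2n-s}\rangle$. (d) Let $I=\langle f,\ 2uy^{m_1}\rangle$ with $f=y^s+2uy^th(x)$, $n<s\le2n-1$,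 $0\le t<s-n$, $1+t\le m_1<T_1(f)$, and $h$ a unit. If $t\ge s+m_1-2n$, then $$A(I)=\langle y^{n-m_1}+uy^{2n-m_1-s+t}(1+y^{n/2})h(x),\ uy^{2n-s}\rangle,$$ $$I^\perp=\langle y^{n-m_1}+ux^{s-n-t}y^{2n-m_1-s+t}\bigl(1+(\tfrac1x+1)^{n/2}\bigr)h(1/x),\ uy^{2n-s}\rangle .$$ If $t<s+m_1-2n$, then $A(I)=I^\perp=\langle y^{n-t},\ uy^{2n-s}\rangle$. (e) Let $I=\langle y^s+uy^t(2h_1(x)+y^lh_2(x)),\ uy^m\rangle$ with $n<s\le2n-1$, $0\le t<s-n$, $t+l+1\le m<n$, and $h_1,h_2$ units. If $t+l\ge s+m-2n$, then $$A(I)=\langle y^{2n-m}+uy^{2n-m-s+t+l}h_2(x),\ uy^{2n-s}\rangle,\qquad I^\perp=\langle y^{2n-m}+ux^{s-t-l}y^{2n-m-s+t+l}h_2(1/x),\ uy^{2n-s}\rangle .$$ If $t+l<s+m-2n$, then $A(I)=I^\perp=\langle y^{2n-l},\ uy^{2n-s}\rangle$. (f) Let $I=\langle f,\ 2uy^{m_1}\rangle$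 with $f=y^s+uy^t(2h_1(x)+y^lh_2(x))$, $n<s\le2n-1$, $0\le t<s-n$, $0\le l<n$, $t<m_1<T_1(f)$, and $h_1,h_2$ units. If $t+l\ge s+m_1-n$, then $$A(I)=\langle y^{n-m_1}+uy^{n-m_1-s+t+l}h'(x),\ uy^{2n-s}\rangle,\qquad I^\perp=\langle y^{n-m_1}+ux^{s-t-l}y^{n-m_1-s+t+l}h''(x),\ uy^{2n-s}\rangle,$$ where $h'(x)=h_1(x)(1+y^{n/2})y^{n-l}+h_2(x)$ and $h''(x)=h_1(1/x)\bigl(1+(\tfrac1x+1)^{n/2}\bigr)(\tfrac1x+1)^{n-l}+h_2(1/x)$. If $t+l<s+m_1-n$, then $A(I)=I^\perp=\langle y^{2n-l},\ uy^{2n-s}\rangle$. -/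

import Mathlib

open Polynomial

noncomputable section

namespace Negacyclic

/-- The ring `R = ℤ₄ + uℤ₄` with `u² = 0`. -/
abbrev R : Type := DualNumber (ZMod 4)

/-- `R_n = R[x] / ⟨x^n + 1⟩`. -/
abbrev Rn (n : ℕ) : Type := AdjoinRoot (X ^ n + 1 : R[X])

/-- `R_n'' = ℤ₂[x] / ⟨x^n + 1⟩`. -/
abbrev Rn2 (n : ℕ) : Type := AdjoinRoot (X ^ n + 1 : (ZMod 2)[X])

/-- The class of `x` in `R_n`. -/
def x (n : ℕ) : Rn n := AdjoinRoot.root (X ^ n + 1 : R[X])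

/-- The element `x + 1` of `R_n`. -/
def y (n : ℕ) : Rn n := x n + 1

/-- The element `u` of `R_n`. -/
def u (n : ℕ) : Rn n := AdjoinRoot.of (X ^ n + 1 : R[X]) (DualNumber.eps : R)

/-- The inverse `1/x = -x^(n-1)` of `x` in `R_n`. -/
def xInv (n : ℕ) : Rn n := -(x n) ^ (n - 1)

theorem x_pow (n : ℕ) : x n ^ n = -1 := by
  have h := AdjoinRoot.eval₂_root (X ^ n + 1 : R[X])
  simp only [eval₂_add, eval₂_pow, eval₂_X, eval₂_one] at h
  exact eq_neg_of_add_eq_zero_left h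

theorem x_mul_xInv (n : ℕ) (hn : 0 < n) : x n * xInv n = 1 := by
  have h : x n * xInv n = -(x n ^ (n - 1 + 1)) := by
    unfold xInv
    ring
  rw [h, Nat.sub_add_cancel hn, x_pow, neg_neg]

/-- The element `h(x)` of `R_n`, for `h` a polynomial over `ℤ₄`. -/
def at_x (n : ℕ) (h : (ZMod 4)[X]) : Rn n := aeval (x n) h

/-- The element `h(1/x)` of `R_n`, for `h` a polynomial over `ℤ₄`. -/
def at_xInv (n : ℕ) (h : (ZMod 4)[X]) : Rn n := aeval (xInv n) h

/-- `h` is a unit in `R_n''`: the reduction of `h` modulo `2` is invertible modulo `x^n + 1`. -/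
def UnitMod2 (n : ℕ) (h : (ZMod 4)[X]) : Prop :=
  IsUnit (AdjoinRoot.mk (X ^ n + 1 : (ZMod 2)[X])
    (h.map (ZMod.castHom (by norm_num : 2 ∣ 4) (ZMod 2))) : Rn2 n)

/-- The smallest `T` such that `u (x+1)^T` lies in the principal ideal `⟨f⟩`. -/
def T (n : ℕ) (f : Rn n) : ℕ := sInf {T : ℕ | u n * y n ^ T ∈ Ideal.span {f}}

/-- The smallest `T₁` such that `2u (x+1)^T₁` lies in the principal ideal `⟨f⟩`. -/
def T₁ (n : ℕ) (f : Rn n) : ℕ := sInf {T : ℕ | 2 * u n * y n ^ T ∈ Ideal.span {f}}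

/-- The identification of `R^n` with `R_n`: `(c₀, …, c_{n-1}) ↦ c₀ + c₁ x + ⋯ + c_{n-1} x^(n-1)`. -/
def toPoly (n : ℕ) : (Fin n → R) →ₗ[R] Rn n :=
  Fintype.linearCombination R (fun i : Fin n => x n ^ (i : ℕ))

/-- The negacyclic code in `R^n` that corresponds to an ideal of `R_n`. -/
def code (n : ℕ) (I : Ideal (Rn n)) : Submodule R (Fin n → R) :=
  (I.restrictScalars R).comap (toPoly n)

/-- The Euclidean dual `C^⊥` of a linear code `C` over `R`. -/
def dual {n : ℕ} (C : Submodule R (Fin n → R)) : Submodule R (Fin n → R) where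
  carrier := {b | ∀ a ∈ C, a ⬝ᵥ b = 0}
  zero_mem' := fun a _ => dotProduct_zero a
  add_mem' := fun {b c} hb hc a ha => by rw [dotProduct_add, hb a ha, hc a ha, add_zero]
  smul_mem' := fun r b hb a ha => by rw [dotProduct_smul, hb a ha, smul_zero]

end Negacyclic

end

open Negacyclic

open Polynomial

noncomputable section

namespace Negacyclic

/-! In `R_n` the number 2 is a unit times `y^n`: `y^n = 2x^(n/2)` and `2 = y^n(1 + y^(n/2))`. Hence
`y^(2n) = 0`, and `R_n` is local with nilpotent maximal ideal `⟨y, u⟩`. As `u y^j ≠ 0` for `j < 2n`,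
anything killing `u y^m` has the form `c y^(2n-m) + u b`. Killing `y^s + u g` as well then fixes `u
b` modulo `u y^(2n-s)`, which gives the annihilator (`annihilator_span`). Replacing 2 by powers of
`y` brings all six families to this one shape.

If `H` is a unit and `f = y^s + u y^t H`, then `y^(2n-s) f = u y^(2n-s+t) H`. So `u y^m ∈ ⟨f⟩` once
`t + 2n ≤ s + m`. This contradicts minimality of `T` or `T₁`, or non-principality of `I`; the second
alternatives in (b), (d), (e), (f) are therefore vacuous.

For duals, the constant coefficient of `a(x) b(1/x)` is the Euclidean product. Thus `I^⊥` is the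
image of `A(I)` under `x ↦ 1/x` (`mem_dual_code_iff`), and `y ↦ y/x` accounts for the powers of `x`.
-/

theorem four_eq_zero (n : ℕ) : (4 : Rn n) = 0 := by
  have h : ((4 : ZMod 4)) = 0 := by decide
  have := congrArg (algebraMap (ZMod 4) (Rn n)) h
  simpa only [map_ofNat, map_zero] using this

theorem u_sq (n : ℕ) : u n * u n = 0 := by
  rw [u, ← map_mul, DualNumber.eps_mul_eps, map_zero]

/-- Repeated squaring: every new cross term has a coefficient divisible by 4. At `a = x` and
exponent `n`, the outer terms cancel because `x^n = -1`. -/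
theorem add_one_pow_two_pow {A : Type*} [CommRing A] (h4 : (4 : A) = 0) (a : A) (j : ℕ) :
    (a + 1) ^ 2 ^ (j + 1) = a ^ 2 ^ (j + 1) + 2 * a ^ 2 ^ j + 1 := by
  induction j with
  | zero => ring
  | succ j ih =>
    rw [pow_succ 2 (j + 1), pow_mul, ih, pow_mul, pow_succ 2 j, pow_mul]
    linear_combination (a ^ 2 ^ j * (a ^ 2 ^ j) ^ 2 + (a ^ 2 ^ j) ^ 2 + a ^ 2 ^ j) * h4

/-! ### Arithmetic of `y` and `u`: the relation between 2 and `y^n`, and locality. -/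

section

variable {k n : ℕ}

theorem half_two_pow (hk : 1 ≤ k) (hn : n = 2 ^ k) : n / 2 = 2 ^ (k - 1) := by
  obtain ⟨j, rfl⟩ := Nat.exists_eq_add_of_le' hk
  rw [hn, pow_succ, Nat.mul_div_cancel _ two_pos, Nat.add_sub_cancel]

theorem y_pow_eq_two_mul_x_pow (hk : 1 ≤ k) (hn : n = 2 ^ k) :
    y n ^ n = 2 * x n ^ (n / 2) := by
  have h2 := half_two_pow hk hn
  obtain ⟨j, rfl⟩ := Nat.exists_eq_add_of_le' hk
  rw [h2]
  have h := add_one_pow_two_pow (four_eq_zero n) (x n) j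
  rw [← hn, x_pow] at h
  rw [y, h, Nat.add_sub_cancel]
  ring

theorem two_mul_one_add_y_pow_half (hk : 1 ≤ k) (hn : n = 2 ^ k) :
    2 * (1 + y n ^ (n / 2)) = 2 * x n ^ (n / 2) := by
  rw [half_two_pow hk hn]
  rcases Nat.eq_zero_or_pos (k - 1) with h | h
  · rw [h, y]
    linear_combination four_eq_zero n
  · obtain ⟨j, hj⟩ := Nat.exists_eq_add_of_le' h
    rw [hj, y, add_one_pow_two_pow (four_eq_zero n)]
    linear_combination (1 + x n ^ 2 ^ j) * four_eq_zero n

theorem y_pow_eq (hk : 1 ≤ k) (hn : n = 2 ^ k) : y n ^ n = 2 * (1 + y n ^ (n / 2)) := by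
  rw [y_pow_eq_two_mul_x_pow hk hn, two_mul_one_add_y_pow_half hk hn]

theorem two_eq (hk : 1 ≤ k) (hn : n = 2 ^ k) : (2 : Rn n) = y n ^ n * (1 + y n ^ (n / 2)) := by
  have h : x n ^ (n / 2) * x n ^ (n / 2) = -1 := by
    have h2 : n / 2 + n / 2 = n := by
      rw [half_two_pow hk hn, ← two_mul, ← pow_succ', Nat.sub_add_cancel hk, hn]
    rw [← pow_add, h2, x_pow]
  rw [y_pow_eq_two_mul_x_pow hk hn]
  linear_combination -x n ^ (n / 2) * two_mul_one_add_y_pow_half hk hn - 2 * h + four_eq_zero n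

theorem y_pow_eq_zero (hk : 1 ≤ k) (hn : n = 2 ^ k) {j : ℕ} (hj : 2 * n ≤ j) : y n ^ j = 0 := by
  obtain ⟨i, rfl⟩ := Nat.exists_eq_add_of_le hj
  rw [pow_add, two_mul, pow_add, y_pow_eq_two_mul_x_pow hk hn]
  linear_combination (x n ^ (n / 2)) ^ 2 * y n ^ i * four_eq_zero n

theorem two_mul_y_pow_eq_zero (hk : 1 ≤ k) (hn : n = 2 ^ k) {j : ℕ} (hj : n ≤ j) :
    2 * y n ^ j = 0 := by
  rw [two_eq hk hn, mul_right_comm, ← pow_add, y_pow_eq_zero hk hn (by omega), zero_mul]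

theorem isNilpotent_y (hk : 1 ≤ k) (hn : n = 2 ^ k) : IsNilpotent (y n) :=
  ⟨2 * n, y_pow_eq_zero hk hn le_rfl⟩

theorem isNilpotent_u (n : ℕ) : IsNilpotent (u n) :=
  ⟨2, by rw [sq, u_sq]⟩

theorem isNilpotent_of_mem (hk : 1 ≤ k) (hn : n = 2 ^ k) {r : Rn n}
    (hr : r ∈ Ideal.span {y n, u n}) : IsNilpotent r := by
  obtain ⟨a, b, rfl⟩ := Ideal.mem_span_pair.mp hr
  exact (Commute.all _ _).isNilpotent_add ((Commute.all _ _).isNilpotent_mul_left (isNilpotent_y hk hn))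
    ((Commute.all _ _).isNilpotent_mul_left (isNilpotent_u n))

theorem aeval_sub_mem {A : Type*} [CommRing A] [Algebra A (Rn n)] (p : A[X]) :
    aeval (x n) p - algebraMap A (Rn n) (p.eval (-1)) ∈ Ideal.span {y n, u n} := by
  have h : X + 1 ∣ p - C (p.eval (-1)) := by
    have := X_sub_C_dvd_sub_C_eval (a := (-1 : A)) (p := p)
    rwa [C_neg, C_1, sub_neg_eq_add] at this
  obtain ⟨q, hq⟩ := h
  have h2 := congrArg (aeval (x n)) hq
  simp only [map_sub, aeval_C, map_mul, map_add, aeval_X, map_one] at h2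
  rw [h2]
  exact Ideal.mul_mem_right _ _ (Ideal.subset_span (Or.inl rfl))

theorem two_mem (hk : 1 ≤ k) (hn : n = 2 ^ k) : (2 : Rn n) ∈ Ideal.span {y n, u n} := by
  rw [two_eq hk hn]
  have h0 : n ≠ 0 := by rw [hn]; positivity
  have hy : y n ∈ Ideal.span {y n, u n} := Ideal.subset_span (Or.inl rfl)
  exact Ideal.mul_mem_right _ _ (Ideal.pow_mem_of_mem _ hy _ (Nat.pos_of_ne_zero h0))

theorem algebraMap_zmod_mem_or_isUnit (hk : 1 ≤ k) (hn : n = 2 ^ k) (a : ZMod 4) :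
    algebraMap (ZMod 4) (Rn n) a ∈ Ideal.span {y n, u n} ∨
      IsUnit a := by
  have h : a = 0 ∨ a = 2 ∨ IsUnit a := by
    have : ∀ a : ZMod 4, a = 0 ∨ a = 2 ∨ a * a = 1 := by decide
    rcases this a with h | h | h
    · exact Or.inl h
    · exact Or.inr (Or.inl h)
    · exact Or.inr (Or.inr (IsUnit.of_mul_eq_one _ h))
  rcases h with rfl | rfl | h
  · left; simp
  · left; rw [map_ofNat]; exact two_mem hk hn
  · exact Or.inr h

theorem isUnit_of_sub_mem (hk : 1 ≤ k) (hn : n = 2 ^ k) {r c : Rn n} (hc : IsUnit c)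
    (h : r - c ∈ Ideal.span {y n, u n}) : IsUnit r := by
  have := (isNilpotent_of_mem hk hn h).isUnit_add_left_of_commute hc (Commute.all _ _)
  simpa using this

theorem algebraMap_R (a : R) : algebraMap R (Rn n) a =
    algebraMap (ZMod 4) (Rn n) a.fst + u n * algebraMap (ZMod 4) (Rn n) a.snd := by
  have h : a = algebraMap (ZMod 4) R a.fst + DualNumber.eps * algebraMap (ZMod 4) R a.snd := by
    rw [TrivSqZeroExt.algebraMap_eq_inl]
    ext
    · rw [TrivSqZeroExt.fst_add, TrivSqZeroExt.fst_mul, DualNumber.fst_eps, zero_mul, add_zero,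
        TrivSqZeroExt.fst_inl]
    · rw [TrivSqZeroExt.snd_add, DualNumber.snd_mul, DualNumber.fst_eps, DualNumber.snd_eps,
        TrivSqZeroExt.snd_inl, TrivSqZeroExt.fst_inl, zero_mul, one_mul, zero_add, zero_add]
  conv_lhs => rw [h]
  rw [map_add, map_mul, ← IsScalarTower.algebraMap_apply, ← IsScalarTower.algebraMap_apply]
  rfl

/-- Modulo `y` a class is its value at `x = -1`; modulo `u` that value lies in `ℤ₄`, where a
non-unit is 0 or 2, and 2 is a multiple of `y^n`. -/
theorem mem_or_isUnit (hk : 1 ≤ k) (hn : n = 2 ^ k) (r : Rn n) :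
    r ∈ Ideal.span {y n, u n} ∨ IsUnit r := by
  obtain ⟨p, rfl⟩ := AdjoinRoot.mk_surjective r
  rw [← AdjoinRoot.aeval_eq]
  have h := aeval_sub_mem (n := n) p
  change aeval (x n) p - _ ∈ _ at h
  rw [algebraMap_R] at h
  have hu : u n * algebraMap (ZMod 4) (Rn n) (p.eval (-1)).snd ∈ Ideal.span {y n, u n} :=
    Ideal.mul_mem_right _ _ (Ideal.subset_span (Or.inr rfl))
  have h' := add_mem h hu
  rcases algebraMap_zmod_mem_or_isUnit hk hn (p.eval (-1)).fst with h0 | h0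
  · left
    have := add_mem h' h0
    convert this using 1
    change aeval (x n) p = _
    ring
  · right
    refine isUnit_of_sub_mem hk hn (h0.map (algebraMap (ZMod 4) (Rn n))) ?_
    convert h' using 1
    change aeval (x n) p - _ = _
    ring

/-- Since `-1 = 1` modulo 2, evaluation at 1 is defined on `ℤ₂[x]/⟨x^n + 1⟩` and shows that `h(-1)`
is odd; `h(x)` differs from it by a nilpotent. -/
theorem isUnit_at_x (hk : 1 ≤ k) (hn : n = 2 ^ k) {h : (ZMod 4)[X]} (hh : UnitMod2 n h) :
    IsUnit (at_x n h) := by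
  have h4 : ∀ a : ZMod 4, IsUnit (ZMod.castHom (by norm_num : 2 ∣ 4) (ZMod 2) a) → a * a = 1 := by
    decide
  have hev : IsUnit (h.eval (-1)) := by
    let φ : Rn2 n →+* ZMod 2 := AdjoinRoot.lift (RingHom.id _) 1 (by
      simp only [eval₂_add, eval₂_pow, eval₂_X, eval₂_one, one_pow]
      decide)
    have h1 := hh.map φ
    rw [AdjoinRoot.lift_mk, eval₂_map, RingHom.id_comp] at h1
    have h2 : eval₂ (ZMod.castHom (by norm_num : 2 ∣ 4) (ZMod 2)) 1 h =
        ZMod.castHom (by norm_num : 2 ∣ 4) (ZMod 2) (h.eval (-1)) := by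
      rw [← eval₂_at_apply]
      congr 1
    rw [h2] at h1
    exact IsUnit.of_mul_eq_one _ (h4 _ h1)
  exact isUnit_of_sub_mem hk hn (hev.map (algebraMap (ZMod 4) (Rn n))) (aeval_sub_mem h)

theorem monic_X_pow_add_one (hn : n ≠ 0) : (X ^ n + 1 : R[X]).Monic :=
  monic_X_pow_add_C (1 : R) hn

theorem isUnit_x (hn : n ≠ 0) : IsUnit (x n) :=
  IsUnit.of_mul_eq_one _ (x_mul_xInv n (Nat.pos_of_ne_zero hn))

theorem two_mul_eps_ne_zero : (2 * DualNumber.eps : R) ≠ 0 := by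
  intro h
  have := congrArg TrivSqZeroExt.snd h
  rw [two_mul, TrivSqZeroExt.snd_add, DualNumber.snd_eps, TrivSqZeroExt.snd_zero] at this
  exact absurd this (by decide)

/-- The top power suffices: up to a unit `u y^(2n-1)` is `2u y^(n-1)`, represented by a nonzero
polynomial of degree `n - 1`. -/
theorem u_mul_y_pow_ne_zero (hk : 1 ≤ k) (hn : n = 2 ^ k) {j : ℕ} (hj : j < 2 * n) :
    u n * y n ^ j ≠ 0 := by
  intro h
  have h0 : n ≠ 0 := by rw [hn]; positivity
  have h1 : u n * y n ^ (n + (n - 1)) = 0 := by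
    obtain ⟨i, hi⟩ := Nat.exists_eq_add_of_le (show j ≤ n + (n - 1) by omega)
    rw [hi, pow_add, ← mul_assoc, h, zero_mul]
  have h2 : x n ^ (n / 2) * (2 * u n * y n ^ (n - 1)) = 0 := by
    rw [← h1, pow_add, y_pow_eq_two_mul_x_pow hk hn]
    ring
  rw [((isUnit_x h0).pow _).mul_right_eq_zero] at h2
  have h3 : AdjoinRoot.mk (X ^ n + 1 : R[X]) ((X + C 1) ^ (n - 1) * C (2 * DualNumber.eps : R)) = 0 := by
    rw [← h2, y, u, x]
    simp only [map_mul, map_pow, map_add, map_one, AdjoinRoot.mk_C, AdjoinRoot.mk_X, map_ofNat]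
    ring
  have hε := two_mul_eps_ne_zero
  have : Nontrivial R := nontrivial_of_ne _ _ hε
  have hm : ((X + C 1 : R[X]) ^ (n - 1)).Monic := (monic_X_add_C 1).pow _
  have hdeg : ((X + C 1) ^ (n - 1) * C (2 * DualNumber.eps : R)).natDegree = n - 1 := by
    rw [hm.natDegree_mul' (C_ne_zero.mpr hε), natDegree_C, (monic_X_add_C (1 : R)).natDegree_pow,
      natDegree_X_add_C]
    omega
  rw [AdjoinRoot.mk_eq_zero] at h3
  refine (monic_X_pow_add_one h0).not_dvd_of_natDegree_lt ?_ ?_ h3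
  · exact fun hz => C_ne_zero.mpr hε (hm.mul_right_eq_zero_iff.mp hz)
  · rw [hdeg, show (X ^ n + 1 : R[X]) = X ^ n + C 1 by simp, natDegree_X_pow_add_C]
    omega

/-- An element that kills `u y^m` is a multiple of `y^(2n-m)` modulo `u`. -/
theorem exists_eq_of_mul_eq_zero (hk : 1 ≤ k) (hn : n = 2 ^ k) {m : ℕ} {r : Rn n}
    (h : r * (u n * y n ^ m) = 0) : ∃ c b, r = c * y n ^ (2 * n - m) + u n * b := by
  have key : ∀ j, j ≤ 2 * n - m → ∃ c b, r = c * y n ^ j + u n * b := by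
    intro j
    induction j with
    | zero => exact fun _ => ⟨r, 0, by simp⟩
    | succ j ih =>
      intro hj
      obtain ⟨c, b, rfl⟩ := ih (by omega)
      -- A unit `c` would force `u y^(j+m) = 0` with `j + m < 2n`; so `c ∈ ⟨y, u⟩` and one more `y`
      -- splits off.
      rcases mem_or_isUnit hk hn c with hc | hc
      · obtain ⟨p, q, rfl⟩ := Ideal.mem_span_pair.mp hc
        exact ⟨p, q * y n ^ j + b, by ring⟩
      · exfalso
        refine u_mul_y_pow_ne_zero hk hn (j := j + m) (by omega) ?_
        rw [← hc.mul_right_eq_zero]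
        linear_combination h - b * y n ^ m * u_sq n
  exact key _ le_rfl

theorem mem_span_of_u_mul_y_pow (hk : 1 ≤ k) (hn : n = 2 ^ k) {s : ℕ} {b : Rn n}
    (h : b * (u n * y n ^ s) = 0) : ∃ c, u n * b = c * (u n * y n ^ (2 * n - s)) := by
  obtain ⟨c, d, rfl⟩ := exists_eq_of_mul_eq_zero hk hn h
  exact ⟨c, by linear_combination d * u_sq n⟩

/-! ### Annihilators of two-generator ideals, and membership in `⟨f⟩`. -/

theorem mem_annihilator_span_pair {A : Type*} [CommRing A] (r a b : A) :
    r ∈ Submodule.annihilator (Ideal.span {a, b}) ↔ r * a = 0 ∧ r * b = 0 := by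
  rw [Ideal.span, Submodule.mem_annihilator_span]
  simp

/-- The annihilator of `⟨y^s + u g, u y^m⟩`. -/
theorem annihilator_span (hk : 1 ≤ k) (hn : n = 2 ^ k) {s m : ℕ} {g w : Rn n}
    (hms : m ≤ s) (hs : s ≤ 2 * n)
    (hw : u n * y n ^ (2 * n - m) * g = u n * y n ^ s * w)
    (h2 : ∃ c, 2 * (u n * w) = c * (u n * y n ^ (2 * n - s))) :
    Submodule.annihilator (Ideal.span {y n ^ s + u n * g, u n * y n ^ m}) =
      Ideal.span {y n ^ (2 * n - m) + u n * w, u n * y n ^ (2 * n - s)} := by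
  have hz1 : y n ^ (2 * n - m) * y n ^ s = 0 := by
    rw [← pow_add]; exact y_pow_eq_zero hk hn (by omega)
  have hz2 : y n ^ (2 * n - m) * y n ^ m = 0 := by
    rw [← pow_add]; exact y_pow_eq_zero hk hn (by omega)
  have hz3 : y n ^ (2 * n - s) * y n ^ s = 0 := by
    rw [← pow_add]; exact y_pow_eq_zero hk hn (by omega)
  obtain ⟨e, he⟩ := h2
  ext r
  rw [mem_annihilator_span_pair, Ideal.mem_span_pair]
  constructor
  · rintro ⟨hf, hm⟩
    obtain ⟨c, b, rfl⟩ := exists_eq_of_mul_eq_zero hk hn hm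
    -- Killing `y^s + u g` means `u y^s (b + c w) = 0`, so the natural second term is `-u w`. The
    -- sign is immaterial because `2 u w ∈ ⟨u y^(2n-s)⟩`.
    obtain ⟨d, hd⟩ := mem_span_of_u_mul_y_pow hk hn (s := s) (b := b + c * w) (by
      linear_combination hf - c * hz1 - b * g * u_sq n - c * hw)
    exact ⟨c, d - c * e, by linear_combination -hd + c * he⟩
  · rintro ⟨a, b, rfl⟩
    constructor
    · linear_combination a * hz1 + (a * w * g + b * y n ^ (2 * n - s) * g) * u_sq n + a * hw +
        b * u n * hz3 + a * y n ^ s * he + a * e * u n * hz3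
    · linear_combination a * u n * hz2 + (a * w * y n ^ m + b * y n ^ (2 * n - s) * y n ^ m) * u_sq n

theorem two_mul_u_mul (hk : 1 ≤ k) (hn : n = 2 ^ k) {i j : ℕ} (H : Rn n) (hij : j ≤ n + i) :
    ∃ c, 2 * (u n * (y n ^ i * H)) = c * (u n * y n ^ j) := by
  refine ⟨y n ^ (n + i - j) * (1 + y n ^ (n / 2)) * H, ?_⟩
  have h : y n ^ n * y n ^ i = y n ^ (n + i - j) * y n ^ j := by
    rw [← pow_add, ← pow_add]; congr 1; omega
  linear_combination (u n * (y n ^ i * H)) * two_eq hk hn + u n * (1 + y n ^ (n / 2)) * H * h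

theorem span_two_mul (hk : 1 ≤ k) (hn : n = 2 ^ k) (f : Rn n) (m : ℕ) :
    Ideal.span {f, 2 * u n * y n ^ m} = Ideal.span {f, u n * y n ^ (n + m)} := by
  apply le_antisymm <;> rw [Ideal.span_le, Set.pair_subset_iff] <;>
    refine ⟨Ideal.subset_span (Or.inl rfl), Ideal.mem_span_pair.mpr ?_⟩
  · exact ⟨0, 1 + y n ^ (n / 2), by
      rw [pow_add]; linear_combination -u n * y n ^ m * two_eq hk hn⟩
  · exact ⟨0, 1 + y n ^ (n / 2), by
      rw [pow_add]; linear_combination -u n * y n ^ m * y_pow_eq hk hn⟩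

theorem u_mul_y_pow_mem_of_le {s m : ℕ} (g : Rn n) (h : s ≤ m) :
    u n * y n ^ m ∈ Ideal.span {y n ^ s + u n * g} := by
  obtain ⟨i, rfl⟩ := Nat.exists_eq_add_of_le h
  exact Ideal.mem_span_singleton'.mpr ⟨u n * y n ^ i, by
    rw [pow_add]; linear_combination g * y n ^ i * u_sq n⟩

theorem u_mul_y_pow_mem_of_isUnit (hk : 1 ≤ k) (hn : n = 2 ^ k) {s t m : ℕ} {H : Rn n}
    (hH : IsUnit H) (hs : s ≤ 2 * n) (h : t + 2 * n ≤ s + m) :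
    u n * y n ^ m ∈ Ideal.span {y n ^ s + u n * (y n ^ t * H)} := by
  obtain ⟨v, hv⟩ := hH.exists_right_inv
  obtain ⟨i, rfl⟩ := Nat.exists_eq_add_of_le (show 2 * n - s + t ≤ m by omega)
  have hz : y n ^ (2 * n - s) * y n ^ s = 0 := by
    rw [← pow_add]; exact y_pow_eq_zero hk hn (by omega)
  exact Ideal.mem_span_singleton'.mpr ⟨y n ^ (2 * n - s) * v * y n ^ i, by
    rw [pow_add, pow_add]
    linear_combination v * y n ^ i * hz + u n * y n ^ (2 * n - s) * y n ^ t * y n ^ i * hv⟩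

theorem u_mul_y_pow_notMem_of_lt_T {f : Rn n} {m : ℕ} (h : m < T n f) :
    u n * y n ^ m ∉ Ideal.span {f} :=
  Nat.notMem_of_lt_sInf h

theorem u_mul_y_pow_notMem_of_lt_T₁ (hk : 1 ≤ k) (hn : n = 2 ^ k) {f : Rn n} {m : ℕ}
    (h : m < T₁ n f) : u n * y n ^ (n + m) ∉ Ideal.span {f} := by
  intro hm
  refine Nat.notMem_of_lt_sInf h ?_
  have : 2 * u n * y n ^ m = (1 + y n ^ (n / 2)) * (u n * y n ^ (n + m)) := by
    rw [pow_add]; linear_combination u n * y n ^ m * two_eq hk hn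
  change 2 * u n * y n ^ m ∈ Ideal.span {f}
  rw [this]
  exact Ideal.mul_mem_left _ _ hm

end

/-! ### The involution `x ↦ 1/x` and the Euclidean dual. -/

section

variable {n : ℕ}

theorem x_pow_mul_xInv_pow (hn : n ≠ 0) (i : ℕ) : x n ^ i * xInv n ^ i = 1 := by
  rw [← mul_pow, x_mul_xInv n (Nat.pos_of_ne_zero hn), one_pow]

theorem xInv_pow (hn : n ≠ 0) : xInv n ^ n = -1 := by
  have h := x_pow_mul_xInv_pow hn n
  rw [x_pow] at h
  linear_combination -h

/-- The involution `x ↦ 1/x` of `R_n`. -/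
def conj (hn : n ≠ 0) : Rn n →ₐ[R] Rn n :=
  AdjoinRoot.liftAlgHom _ (Algebra.ofId R (Rn n)) (xInv n) (by
    simp only [eval₂_add, eval₂_pow, eval₂_X, eval₂_one, xInv_pow hn, neg_add_cancel])

@[simp] theorem conj_x (hn : n ≠ 0) : conj hn (x n) = xInv n :=
  AdjoinRoot.liftAlgHom_root _ _ _ _

@[simp] theorem conj_u (hn : n ≠ 0) : conj hn (u n) = u n :=
  (conj hn).commutes _

@[simp] theorem conj_xInv (hn : n ≠ 0) : conj hn (xInv n) = x n := by
  have h := congrArg (conj hn) (x_pow_mul_xInv_pow hn 1)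
  rw [pow_one, pow_one, map_mul, map_one, conj_x] at h
  have h1 := x_pow_mul_xInv_pow hn 1
  linear_combination x n * h - conj hn (xInv n) * h1

@[simp] theorem conj_conj (hn : n ≠ 0) (r : Rn n) : conj hn (conj hn r) = r := by
  have h : (conj hn).comp (conj hn) = AlgHom.id R (Rn n) := by
    apply AdjoinRoot.algHom_ext
    change conj hn (conj hn (x n)) = x n
    rw [conj_x, conj_xInv]
  exact congrArg (fun f => f r) h

theorem conj_y (hn : n ≠ 0) : conj hn (y n) = xInv n * y n := by
  have h1 := x_pow_mul_xInv_pow hn 1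
  rw [y, map_add, map_one, conj_x]
  linear_combination -h1

theorem conj_y' (hn : n ≠ 0) : conj hn (y n) = xInv n + 1 := by
  rw [y, map_add, map_one, conj_x]

@[simp] theorem conj_at_x (hn : n ≠ 0) (h : (ZMod 4)[X]) : conj hn (at_x n h) = at_xInv n h := by
  rw [at_x, at_xInv, ← conj_x hn]
  exact (aeval_algHom_apply ((conj hn).restrictScalars (ZMod 4)) _ _).symm

theorem toPoly_apply (a : Fin n → R) : toPoly n a = ∑ i, a i • x n ^ (i : ℕ) :=
  Fintype.linearCombination_apply _ _ _

/-- The constant coefficient of the representative of degree less than `n`. -/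
def constCoeff (hn : n ≠ 0) : Rn n →ₗ[R] R :=
  (lcoeff R 0).comp (AdjoinRoot.modByMonicHom (monic_X_pow_add_one hn))

theorem nontrivial_R : Nontrivial R := nontrivial_of_ne _ _ two_mul_eps_ne_zero

theorem natDegree_X_pow_add_one : (X ^ n + 1 : R[X]).natDegree = n := by
  have := nontrivial_R
  exact natDegree_X_pow_add_C (r := (1 : R))

theorem constCoeff_x_pow (hn : n ≠ 0) {i : ℕ} (hi : i < n) :
    constCoeff hn (x n ^ i) = if i = 0 then 1 else 0 := by
  have := nontrivial_R
  have h : x n ^ i = AdjoinRoot.mk (X ^ n + 1 : R[X]) (X ^ i) := by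
    rw [map_pow, AdjoinRoot.mk_X, x]
  have h2 : (X ^ i : R[X]) %ₘ (X ^ n + 1) = X ^ i := by
    rw [modByMonic_eq_self_iff (monic_X_pow_add_one hn)]
    apply degree_lt_degree
    rw [natDegree_X_pow_add_one, natDegree_X_pow]
    exact hi
  rw [h, constCoeff, LinearMap.comp_apply, AdjoinRoot.modByMonicHom_mk, h2, lcoeff_apply,
    coeff_X_pow]
  simp only [eq_comm]

theorem constCoeff_x_pow_mul_xInv_pow (hn : n ≠ 0) {i j : ℕ} (hi : i < n) (hj : j < n) :
    constCoeff hn (x n ^ i * xInv n ^ j) = if i = j then 1 else 0 := by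
  rcases le_or_gt j i with h | h
  · obtain ⟨d, rfl⟩ := Nat.exists_eq_add_of_le h
    have : x n ^ (j + d) * xInv n ^ j = x n ^ d := by
      rw [pow_add]
      linear_combination x n ^ d * x_pow_mul_xInv_pow hn j
    rw [this, constCoeff_x_pow hn (by omega)]
    simp
  · have : x n ^ i * xInv n ^ j = -x n ^ (n + i - j) := by
      have h1 : x n ^ (n + i - j) * x n ^ j = -x n ^ i := by
        rw [← pow_add, Nat.sub_add_cancel (by omega), pow_add, x_pow, neg_one_mul]
      linear_combination xInv n ^ j * h1 - x n ^ (n + i - j) * x_pow_mul_xInv_pow hn j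
    -- Here `0 < n + i - j < n`, so the constant coefficient vanishes.
    rw [this, map_neg, constCoeff_x_pow hn (by omega), if_neg (by omega), if_neg (by omega),
      neg_zero]

theorem constCoeff_toPoly_mul_xInv_pow (hn : n ≠ 0) (a : Fin n → R) (j : Fin n) :
    constCoeff hn (toPoly n a * xInv n ^ (j : ℕ)) = a j := by
  rw [toPoly_apply, Finset.sum_mul, map_sum]
  simp only [smul_mul_assoc, map_smul, constCoeff_x_pow_mul_xInv_pow hn (Fin.is_lt _) j.is_lt,
    Fin.val_inj]
  simp

theorem constCoeff_toPoly_mul_conj (hn : n ≠ 0) (a b : Fin n → R) :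
    constCoeff hn (toPoly n a * conj hn (toPoly n b)) = a ⬝ᵥ b := by
  rw [toPoly_apply b, map_sum, Finset.mul_sum, map_sum, dotProduct]
  refine Finset.sum_congr rfl fun j _ => ?_
  rw [map_smul, map_pow, conj_x, mul_smul_comm, map_smul, constCoeff_toPoly_mul_xInv_pow, smul_eq_mul,
    mul_comm]

theorem toPoly_surjective (hn : n ≠ 0) : Function.Surjective (toPoly n) := by
  intro r
  let p := AdjoinRoot.modByMonicHom (monic_X_pow_add_one hn) r
  refine ⟨fun i => p.coeff i, ?_⟩
  have := nontrivial_R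
  have hp : p.natDegree < n := by
    obtain ⟨q, rfl⟩ := AdjoinRoot.mk_surjective r
    have h := natDegree_modByMonic_lt q (monic_X_pow_add_one hn) (fun h => hn (by
      rw [← natDegree_X_pow_add_one (n := n), h, natDegree_one]))
    rwa [natDegree_X_pow_add_one] at h
  rw [toPoly_apply, ← AdjoinRoot.mk_leftInverse (monic_X_pow_add_one hn) r,
    Fin.sum_univ_eq_sum_range (fun i => p.coeff i • x n ^ i) n]
  change _ = AdjoinRoot.mk _ p
  rw [← AdjoinRoot.aeval_eq, aeval_eq_sum_range' hp]
  rfl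

/-- The dual code of an ideal corresponds to the image of its annihilator under `x ↦ 1/x`. -/
theorem mem_dual_code_iff (hn : n ≠ 0) (I : Ideal (Rn n)) (b : Fin n → R) :
    b ∈ dual (code n I) ↔ conj hn (toPoly n b) ∈ Submodule.annihilator I := by
  rw [Submodule.mem_annihilator]
  constructor
  · intro hb r hr
    -- Coefficient `j` of `r b(1/x)` is the constant coefficient after multiplying by `x^(-j)`, that
    -- is, the product of `b` with the codeword `r x^(-j) ∈ I`.
    obtain ⟨c, hc⟩ := toPoly_surjective hn (r * conj hn (toPoly n b))
    have hc0 : c = 0 := by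
      ext1 j
      obtain ⟨a, ha⟩ := toPoly_surjective hn (r * xInv n ^ (j : ℕ))
      rw [← constCoeff_toPoly_mul_xInv_pow hn c j, hc, mul_right_comm, ← ha,
        constCoeff_toPoly_mul_conj]
      refine hb a ?_
      change toPoly n a ∈ I
      rw [ha]
      exact Ideal.mul_mem_right _ _ hr
    rw [smul_eq_mul, mul_comm, ← hc, hc0, map_zero]
  · intro h a ha
    rw [← constCoeff_toPoly_mul_conj hn, mul_comm]
    have := h (toPoly n a) ha
    rw [smul_eq_mul] at this
    rw [this, map_zero]

theorem conj_mem_span_pair_iff (hn : n ≠ 0) {p q p' q' v w r : Rn n} (hv : IsUnit v) (hw : IsUnit w)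
    (hp : v * conj hn p = p') (hq : w * conj hn q = q') :
    conj hn r ∈ Ideal.span {p, q} ↔ r ∈ Ideal.span {p', q'} := by
  obtain ⟨v', hv'⟩ := hv.exists_left_inv
  obtain ⟨w', hw'⟩ := hw.exists_left_inv
  rw [Ideal.mem_span_pair, Ideal.mem_span_pair]
  constructor
  · rintro ⟨a, b, h⟩
    refine ⟨conj hn a * v', conj hn b * w', ?_⟩
    have h2 := congrArg (conj hn) h
    rw [conj_conj, map_add, map_mul, map_mul] at h2
    rw [← hp, ← hq, ← h2]
    linear_combination conj hn a * conj hn p * hv' + conj hn b * conj hn q * hw'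
  · rintro ⟨a, b, h⟩
    refine ⟨conj hn (a * v), conj hn (b * w), ?_⟩
    rw [← h, ← hp, ← hq]
    simp only [map_add, map_mul, conj_conj]
    ring

/-- Multiplying the image of the first generator by `x^a` clears `x^(-a)` from `y^a` and leaves
`x^(a-e) = x^d` on the `u`-term. -/
theorem dual_code_eq (hn : n ≠ 0) {I : Ideal (Rn n)} {a b d e : ℕ} {H : Rn n}
    (hd : H = 0 ∨ a = d + e)
    (h : Submodule.annihilator I = Ideal.span {y n ^ a + u n * y n ^ e * H, u n * y n ^ b}) :
    dual (code n I) =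
      code n (Ideal.span {y n ^ a + u n * x n ^ d * y n ^ e * conj hn H, u n * y n ^ b}) := by
  ext c
  rw [mem_dual_code_iff hn, h]
  refine conj_mem_span_pair_iff hn ((isUnit_x hn).pow a) ((isUnit_x hn).pow b) ?_ ?_
  · simp only [map_add, map_mul, map_pow, conj_u, conj_y hn, mul_pow]
    have ha := x_pow_mul_xInv_pow hn a
    rcases hd with rfl | rfl
    · rw [map_zero]
      linear_combination y n ^ a * ha
    · have he := x_pow_mul_xInv_pow hn e
      have hx := pow_add (x n) d e
      linear_combination y n ^ (d + e) * ha + u n * y n ^ e * conj hn H * xInv n ^ e * hx +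
        u n * y n ^ e * conj hn H * x n ^ d * he
  · simp only [map_mul, map_pow, conj_u, conj_y hn, mul_pow]
    linear_combination u n * y n ^ b * x_pow_mul_xInv_pow hn b

end

/-! ### The common normal form of the six families. -/

section

variable {k n : ℕ}

/-- Only `y^(2n-m) g` matters, so parts of `g` killed by `y^(2n-m)` may be dropped, as in (c) and
(e). The bound `m ≤ n + t` makes the sign of the `u`-term immaterial. -/
theorem annihilator_span_y_pow (hk : 1 ≤ k) (hn : n = 2 ^ k) {s t m : ℕ} {g H : Rn n}
    (hms : m ≤ s) (hs : s ≤ 2 * n) (hH : H = 0 ∨ (s + m ≤ t + 2 * n ∧ m ≤ n + t))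
    (hg : y n ^ (2 * n - m) * g = y n ^ (2 * n - m) * (y n ^ t * H)) :
    Submodule.annihilator (Ideal.span {y n ^ s + u n * g, u n * y n ^ m}) =
      Ideal.span {y n ^ (2 * n - m) + u n * y n ^ (2 * n + t - (m + s)) * H,
        u n * y n ^ (2 * n - s)} := by
  rw [mul_assoc (u n)]
  rcases hH with rfl | ⟨h1, h2⟩
  · refine annihilator_span hk hn hms hs ?_ ⟨0, by ring⟩
    rw [mul_assoc, hg]
    ring
  · refine annihilator_span hk hn hms hs ?_ (two_mul_u_mul hk hn H (by omega))
    have h : y n ^ (2 * n - m) * y n ^ t = y n ^ s * y n ^ (2 * n + t - (m + s)) := by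
      rw [← pow_add, ← pow_add]; congr 1; omega
    rw [mul_assoc, hg]
    linear_combination u n * H * h

theorem dual_code_eq_of_annihilator_eq (hn : n ≠ 0) {I : Ideal (Rn n)} {a b : ℕ}
    (h : Submodule.annihilator I = Ideal.span {y n ^ a, u n * y n ^ b}) :
    dual (code n I) = code n (Ideal.span {y n ^ a, u n * y n ^ b}) := by
  have := dual_code_eq hn (I := I) (a := a) (b := b) (d := 0) (e := 0) (H := 0) (Or.inl rfl)
    (by rw [h, mul_zero, add_zero])
  rwa [map_zero, mul_zero, add_zero] at this

theorem annihilator_dual_eq (hk : 1 ≤ k) (hn : n = 2 ^ k) {s t m d : ℕ} {g H : Rn n}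
    (hms : m ≤ s) (hs : s ≤ 2 * n)
    (hH : H = 0 ∨ (s + m ≤ t + 2 * n ∧ m ≤ n + t ∧ s = d + t))
    (hg : y n ^ (2 * n - m) * g = y n ^ (2 * n - m) * (y n ^ t * H)) {I : Ideal (Rn n)}
    (hI : I = Ideal.span {y n ^ s + u n * g, u n * y n ^ m}) :
    Submodule.annihilator I =
      Ideal.span {y n ^ (2 * n - m) + u n * y n ^ (2 * n + t - (m + s)) * H,
        u n * y n ^ (2 * n - s)} ∧
    dual (code n I) =
      code n (Ideal.span {y n ^ (2 * n - m) + u n * x n ^ d * y n ^ (2 * n + t - (m + s)) *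
        conj (by rw [hn]; positivity) H, u n * y n ^ (2 * n - s)}) := by
  have h := annihilator_span_y_pow hk hn hms hs (hH.imp_right fun h => ⟨h.1, h.2.1⟩) hg
  rw [← hI] at h
  exact ⟨h, dual_code_eq _ (hH.imp_right fun h => by omega) h⟩

theorem annihilator_dual_eq_of_eq_zero (hk : 1 ≤ k) (hn : n = 2 ^ k) {s m : ℕ} {g : Rn n}
    (hms : m ≤ s) (hs : s ≤ 2 * n) (hg : y n ^ (2 * n - m) * g = 0) {I : Ideal (Rn n)}
    (hI : I = Ideal.span {y n ^ s + u n * g, u n * y n ^ m}) :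
    Submodule.annihilator I = Ideal.span {y n ^ (2 * n - m), u n * y n ^ (2 * n - s)} ∧
    dual (code n I) = code n (Ideal.span {y n ^ (2 * n - m), u n * y n ^ (2 * n - s)}) := by
  have h := annihilator_span_y_pow hk hn (t := 0) (H := 0) hms hs (Or.inl rfl) (by simpa using hg)
  rw [← hI, mul_zero, add_zero] at h
  exact ⟨h, dual_code_eq_of_annihilator_eq (by rw [hn]; positivity) h⟩

theorem isPrincipal_span_pair_of_mem {A : Type*} [CommRing A] {f g : A}
    (h : g ∈ Ideal.span {f}) : (Ideal.span {f, g}).IsPrincipal :=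
  ⟨f, by
    rw [Set.pair_comm]
    exact Submodule.span_insert_eq_span h⟩

theorem u_mul_two_mul_y_pow (hk : 1 ≤ k) (hn : n = 2 ^ k) (t : ℕ) (H : Rn n) :
    2 * u n * y n ^ t * H = u n * (y n ^ (n + t) * ((1 + y n ^ (n / 2)) * H)) := by
  rw [pow_add]
  linear_combination u n * y n ^ t * H * two_eq hk hn

/-- For `l < n` the last factor is a nilpotent plus `H₂`, hence a unit whenever `H₂` is one. -/
theorem u_mul_y_pow_mul_two_add (hk : 1 ≤ k) (hn : n = 2 ^ k) {l : ℕ} (hl : l ≤ n) (t : ℕ)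
    (H₁ H₂ : Rn n) :
    u n * y n ^ t * (2 * H₁ + y n ^ l * H₂) =
      u n * (y n ^ (t + l) * (H₁ * (1 + y n ^ (n / 2)) * y n ^ (n - l) + H₂)) := by
  have h : y n ^ n = y n ^ l * y n ^ (n - l) := by rw [← pow_add, Nat.add_sub_of_le hl]
  rw [pow_add]
  linear_combination u n * y n ^ t * H₁ * two_eq hk hn +
    u n * y n ^ t * H₁ * (1 + y n ^ (n / 2)) * h

theorem isUnit_mul_y_pow_add (hk : 1 ≤ k) (hn : n = 2 ^ k) {j : ℕ} (hj : j ≠ 0) (a : Rn n)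
    {b : Rn n} (hb : IsUnit b) : IsUnit (a * y n ^ j + b) := by
  have h : IsNilpotent (a * y n ^ j) :=
    (Commute.all _ _).isNilpotent_mul_left ((isNilpotent_y hk hn).pow_of_pos hj)
  exact h.isUnit_add_right_of_commute hb (Commute.all _ _)

end

end Negacyclic

end

/-! ### The six families. -/

theorem mainTheorem4 (k n : ℕ) (hk : 1 ≤ k) (hn : n = 2 ^ k)
    (I : Ideal (Rn n)) (hI : ¬ I.IsPrincipal) :
    -- (a)
    (∀ (s t m : ℕ) (h : (ZMod 4)[X]),
      1 ≤ s → s < n → t < m → m < s → (h = 0 ∨ UnitMod2 n h) →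
      I = Ideal.span {y n ^ s + u n * y n ^ t * at_x n h, u n * y n ^ m} →
        Submodule.annihilator I =
          Ideal.span {y n ^ (2 * n - m) + u n * y n ^ (2 * n + t - (m + s)) * at_x n h,
            u n * y n ^ (2 * n - s)} ∧
        dual (code n I) = code n
          (Ideal.span {y n ^ (2 * n - m)
              + u n * x n ^ (s - t) * y n ^ (2 * n + t - (m + s)) * at_xInv n h,
            u n * y n ^ (2 * n - s)})) ∧
    -- (b)
    (∀ (s t m : ℕ) (h : (ZMod 4)[X]),
      n ≤ s → s < 2 * n → t < n → 1 + t ≤ m →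
      m < T n (y n ^ s + u n * y n ^ t * at_x n h) → (h = 0 ∨ UnitMod2 n h) →
      I = Ideal.span {y n ^ s + u n * y n ^ t * at_x n h, u n * y n ^ m} →
        ((h = 0 ∨ s + m ≤ t + 2 * n) →
          Submodule.annihilator I =
            Ideal.span {y n ^ (2 * n - m) + u n * y n ^ (2 * n + t - (m + s)) * at_x n h,
              u n * y n ^ (2 * n - s)} ∧
          dual (code n I) = code n
            (Ideal.span {y n ^ (2 * n - m)
                + u n * x n ^ (s - t) * y n ^ (2 * n + t - (m + s)) * at_xInv n h,
              u n * y n ^ (2 * n - s)})) ∧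
        ((h ≠ 0 ∧ t + 2 * n < s + m) →
          Submodule.annihilator I =
            Ideal.span {y n ^ (s - t) + u n * at_x n h, u n * y n ^ (2 * n - s)} ∧
          dual (code n I) = code n
            (Ideal.span {y n ^ (s - t) + u n * x n ^ (s - t) * at_xInv n h,
              u n * y n ^ (2 * n - s)}))) ∧
    -- (c)
    (∀ (s t m : ℕ) (h : (ZMod 4)[X]),
      n < s → s ≤ 2 * n - 1 → t < s - n → 1 + t ≤ m → m < n → UnitMod2 n h →
      I = Ideal.span {y n ^ s + 2 * u n * y n ^ t * at_x n h, u n * y n ^ m} →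
        Submodule.annihilator I =
          Ideal.span {y n ^ (2 * n - m), u n * y n ^ (2 * n - s)} ∧
        dual (code n I) = code n
          (Ideal.span {y n ^ (2 * n - m), u n * y n ^ (2 * n - s)})) ∧
    -- (d)
    (∀ (s t m₁ : ℕ) (h : (ZMod 4)[X]),
      n < s → s ≤ 2 * n - 1 → t < s - n → 1 + t ≤ m₁ →
      m₁ < T₁ n (y n ^ s + 2 * u n * y n ^ t * at_x n h) → UnitMod2 n h →
      I = Ideal.span {y n ^ s + 2 * u n * y n ^ t * at_x n h, 2 * u n * y n ^ m₁} →
        (s + m₁ ≤ t + 2 * n →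
          Submodule.annihilator I =
            Ideal.span {y n ^ (n - m₁)
                + u n * y n ^ (2 * n + t - (m₁ + s)) * (1 + y n ^ (n / 2)) * at_x n h,
              u n * y n ^ (2 * n - s)} ∧
          dual (code n I) = code n
            (Ideal.span {y n ^ (n - m₁)
                + u n * x n ^ (s - n - t) * y n ^ (2 * n + t - (m₁ + s))
                  * ((1 + (xInv n + 1) ^ (n / 2)) * at_xInv n h),
              u n * y n ^ (2 * n - s)})) ∧
        (t + 2 * n < s + m₁ →
          Submodule.annihilator I =
            Ideal.span {y n ^ (n - t), u n * y n ^ (2 * n - s)} ∧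
          dual (code n I) = code n
            (Ideal.span {y n ^ (n - t), u n * y n ^ (2 * n - s)}))) ∧
    -- (e)
    (∀ (s t l m : ℕ) (h₁ h₂ : (ZMod 4)[X]),
      n < s → s ≤ 2 * n - 1 → t < s - n → t + l + 1 ≤ m → m < n →
      UnitMod2 n h₁ → UnitMod2 n h₂ →
      I = Ideal.span
          {y n ^ s + u n * y n ^ t * (2 * at_x n h₁ + y n ^ l * at_x n h₂), u n * y n ^ m} →
        (s + m ≤ t + l + 2 * n →
          Submodule.annihilator I =
            Ideal.span {y n ^ (2 * n - m) + u n * y n ^ (2 * n + t + l - (m + s)) * at_x n h₂,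
              u n * y n ^ (2 * n - s)} ∧
          dual (code n I) = code n
            (Ideal.span {y n ^ (2 * n - m)
                + u n * x n ^ (s - t - l) * y n ^ (2 * n + t + l - (m + s)) * at_xInv n h₂,
              u n * y n ^ (2 * n - s)})) ∧
        (t + l + 2 * n < s + m →
          Submodule.annihilator I =
            Ideal.span {y n ^ (2 * n - l), u n * y n ^ (2 * n - s)} ∧
          dual (code n I) = code n
            (Ideal.span {y n ^ (2 * n - l), u n * y n ^ (2 * n - s)}))) ∧
    -- (f)
    (∀ (s t l m₁ : ℕ) (h₁ h₂ : (ZMod 4)[X]),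
      n < s → s ≤ 2 * n - 1 → t < s - n → l < n → t < m₁ →
      m₁ < T₁ n (y n ^ s + u n * y n ^ t * (2 * at_x n h₁ + y n ^ l * at_x n h₂)) →
      UnitMod2 n h₁ → UnitMod2 n h₂ →
      I = Ideal.span
          {y n ^ s + u n * y n ^ t * (2 * at_x n h₁ + y n ^ l * at_x n h₂),
            2 * u n * y n ^ m₁} →
        (s + m₁ ≤ t + l + n →
          Submodule.annihilator I =
            Ideal.span {y n ^ (n - m₁)
                + u n * y n ^ (n + t + l - (m₁ + s))
                  * (at_x n h₁ * (1 + y n ^ (n / 2)) * y n ^ (n - l) + at_x n h₂),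
              u n * y n ^ (2 * n - s)} ∧
          dual (code n I) = code n
            (Ideal.span {y n ^ (n - m₁)
                + u n * x n ^ (s - t - l) * y n ^ (n + t + l - (m₁ + s))
                  * (at_xInv n h₁ * (1 + (xInv n + 1) ^ (n / 2)) * (xInv n + 1) ^ (n - l)
                    + at_xInv n h₂),
              u n * y n ^ (2 * n - s)})) ∧
        (t + l + n < s + m₁ →
          Submodule.annihilator I =
            Ideal.span {y n ^ (2 * n - l), u n * y n ^ (2 * n - s)} ∧
          dual (code n I) = code n
            (Ideal.span {y n ^ (2 * n - l), u n * y n ^ (2 * n - s)}))) := by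
  have hn0 : n ≠ 0 := by rw [hn]; positivity
  refine ⟨?_, ?_, ?_, ?_, ?_, ?_⟩
  · intro s t m h _ hsn htm hms _ hIeq
    rw [← conj_at_x hn0]
    rw [mul_assoc (u n)] at hIeq
    exact annihilator_dual_eq hk hn hms.le (by omega)
      (Or.inr ⟨by omega, by omega, by omega⟩) rfl hIeq
  · intro s t m h hns hs2 htn _ hmT hh hIeq
    rw [mul_assoc (u n)] at hIeq hmT
    have hmem := u_mul_y_pow_notMem_of_lt_T hmT
    have hms : m < s := by
      by_contra hc
      exact hmem (u_mul_y_pow_mem_of_le _ (by omega))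
    -- The bound is strict: at equality `u y^m` already lies in `⟨f⟩`.
    have hbd : h = 0 ∨ s + m < t + 2 * n := by
      rcases hh with rfl | hh
      · exact Or.inl rfl
      · right
        by_contra hc
        exact hmem (u_mul_y_pow_mem_of_isUnit hk hn (isUnit_at_x hk hn hh) (by omega) (by omega))
    refine ⟨fun _ => ?_, fun ⟨h0, hlt⟩ => ?_⟩
    · rw [← conj_at_x hn0]
      refine annihilator_dual_eq hk hn hms.le (by omega) ?_ rfl hIeq
      rcases hbd with rfl | hbd
      · exact Or.inl (map_zero _)
      · exact Or.inr ⟨by omega, by omega, by omega⟩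
    · exact absurd (hbd.resolve_left h0) (by omega)
  · intro s t m h hns hs2 htn htm hmn _ hIeq
    rw [u_mul_two_mul_y_pow hk hn] at hIeq
    refine annihilator_dual_eq_of_eq_zero hk hn (by omega) (by omega) ?_ hIeq
    -- The exponent is `(2n - m) + (n + t) ≥ 2n`, as `m < n`.
    rw [← mul_assoc, ← pow_add, y_pow_eq_zero hk hn (by omega), zero_mul]
  · intro s t m h hns hs2 htn htm hmT hh hIeq
    rw [u_mul_two_mul_y_pow hk hn] at hIeq hmT
    rw [span_two_mul hk hn] at hIeq
    have hmem := u_mul_y_pow_notMem_of_lt_T₁ hk hn hmT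
    have hunit : IsUnit ((1 + y n ^ (n / 2)) * at_x n h) := by
      have h2 : n / 2 ≠ 0 := by rw [half_two_pow hk hn]; positivity
      have := isUnit_mul_y_pow_add hk hn h2 1 isUnit_one
      rw [one_mul, add_comm (y n ^ (n / 2))] at this
      exact this.mul (isUnit_at_x hk hn hh)
    have hms : n + m < s := by
      by_contra hc
      exact hmem (u_mul_y_pow_mem_of_le _ (by omega))
    have hbd : s + (n + m) < n + t + 2 * n := by
      by_contra hc
      exact hmem (u_mul_y_pow_mem_of_isUnit hk hn hunit (by omega) (by omega))
    refine ⟨fun _ => ?_, fun hlt => absurd hlt (by omega)⟩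
    -- The general formula is applied with `n + t` and `n + m` in place of `t` and `m`, whence `d =
    -- s - (n + t)`.
    have key := annihilator_dual_eq hk hn hms.le (by omega) (d := s - n - t)
      (Or.inr ⟨by omega, by omega, by omega⟩) rfl hIeq
    rw [show 2 * n - (n + m) = n - m by omega,
      show 2 * n + (n + t) - (n + m + s) = 2 * n + t - (m + s) by omega] at key
    simpa only [map_mul, map_add, map_one, map_pow, conj_y' hn0, conj_at_x, mul_assoc] using key
  · intro s t l m h₁ h₂ hns hs2 htn htm hmn _ hh₂ hIeq
    refine ⟨fun hle => ?_, fun hlt => ?_⟩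
    · rw [mul_assoc (u n)] at hIeq
      rw [← conj_at_x hn0, add_assoc (2 * n) t l, Nat.sub_sub]
      refine annihilator_dual_eq hk hn (by omega) (by omega)
        (Or.inr ⟨by omega, by omega, by omega⟩) ?_ hIeq
      -- The `2h₁` part disappears because `2n - m ≥ n`.
      have h2 : 2 * y n ^ (2 * n - m) = 0 := two_mul_y_pow_eq_zero hk hn (by omega)
      rw [pow_add]
      linear_combination y n ^ t * at_x n h₁ * h2
    · exfalso
      rw [u_mul_y_pow_mul_two_add hk hn (by omega)] at hIeq
      refine hI (hIeq ▸ isPrincipal_span_pair_of_mem ?_)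
      exact u_mul_y_pow_mem_of_isUnit hk hn
        (isUnit_mul_y_pow_add hk hn (by omega) _ (isUnit_at_x hk hn hh₂)) (by omega) (by omega)
  · intro s t l m h₁ h₂ hns hs2 htn hl htm hmT _ hh₂ hIeq
    rw [u_mul_y_pow_mul_two_add hk hn hl.le] at hIeq hmT
    rw [span_two_mul hk hn] at hIeq
    have hmem := u_mul_y_pow_notMem_of_lt_T₁ hk hn hmT
    have hms : n + m < s := by
      by_contra hc
      exact hmem (u_mul_y_pow_mem_of_le _ (by omega))
    have hbd : s + (n + m) < t + l + 2 * n := by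
      by_contra hc
      exact hmem (u_mul_y_pow_mem_of_isUnit hk hn
        (isUnit_mul_y_pow_add hk hn (by omega) _ (isUnit_at_x hk hn hh₂)) (by omega) (by omega))
    refine ⟨fun _ => ?_, fun hlt => absurd hlt (by omega)⟩
    have key := annihilator_dual_eq hk hn hms.le (by omega) (d := s - t - l)
      (Or.inr ⟨by omega, by omega, by omega⟩) rfl hIeq
    rw [show 2 * n - (n + m) = n - m by omega,
      show 2 * n + (t + l) - (n + m + s) = n + t + l - (m + s) by omega] at key
    simpa only [map_mul, map_add, map_one, map_pow, conj_y' hn0, conj_at_x, mul_assoc] using key
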